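/- Let $m, n > 1$ be integers, and let $G_{m,n}$ be the group, under composition, of transformations of the real line generated by $$x \mapsto x+1, \qquad x \mapsto m x, \qquad x \mapsto \operatorname{sgn}(x)\,|x|^{n}.$$ Then $G_{m,n}$ does not embed into the group of $C^1$ diffeomorphisms of the closed interval $[0,1]$; that is, there is no injective group homomorphism from $G_{m,n}$ into the group of all bijections $f$ of $[0,1]$ such that $f$ and $f^{-1}$ are of class $C^1$ on $[0,1]$ (with one-sided derivatives at the endpoints). -/

import Mathlib

/-- The transformation `x ↦ sgn(x) |x| ^ p` of the real line, for `p > 0`. -/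
noncomputable def signedPower (p : ℝ) (hp : 0 < p) : Equiv.Perm ℝ where
  toFun x := Real.sign x * |x| ^ p
  invFun x := Real.sign x * |x| ^ p⁻¹
  left_inv x := by
    dsimp only
    rcases lt_trichotomy x 0 with h | h | h
    · have h1 : 0 < |x| ^ p := Real.rpow_pos_of_pos (abs_pos.mpr h.ne) p
      rw [Real.sign_of_neg h, neg_one_mul, abs_neg, abs_of_pos h1,
        Real.sign_of_neg (neg_lt_zero.mpr h1), Real.rpow_rpow_inv (abs_nonneg x) hp.ne',
        abs_of_neg h]
      ring
    · simp [h]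
    · have h1 : 0 < |x| ^ p := Real.rpow_pos_of_pos (abs_pos.mpr h.ne') p
      rw [Real.sign_of_pos h, one_mul, abs_of_pos h1,
        Real.sign_of_pos h1, Real.rpow_rpow_inv (abs_nonneg x) hp.ne', abs_of_pos h]
      ring
  right_inv x := by
    dsimp only
    rcases lt_trichotomy x 0 with h | h | h
    · have h1 : 0 < |x| ^ p⁻¹ := Real.rpow_pos_of_pos (abs_pos.mpr h.ne) p⁻¹
      rw [Real.sign_of_neg h, neg_one_mul, abs_neg, abs_of_pos h1,
        Real.sign_of_neg (neg_lt_zero.mpr h1), Real.rpow_inv_rpow (abs_nonneg x) hp.ne',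
        abs_of_neg h]
      ring
    · simp [h]
    · have h1 : 0 < |x| ^ p⁻¹ := Real.rpow_pos_of_pos (abs_pos.mpr h.ne') p⁻¹
      rw [Real.sign_of_pos h, one_mul, abs_of_pos h1,
        Real.sign_of_pos h1, Real.rpow_inv_rpow (abs_nonneg x) hp.ne', abs_of_pos h]
      ring

/-- The group (under composition) of transformations of the real line generated by
`x ↦ x + 1`, `x ↦ l * x` and `x ↦ sgn(x) |x| ^ p`, for `l, p > 0`. -/
noncomputable def affinePowerGroup (l p : ℝ) (hl : 0 < l) (hp : 0 < p) :
    Subgroup (Equiv.Perm ℝ) :=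
  Subgroup.closure {Equiv.addRight (1 : ℝ), Equiv.mulLeft₀ l hl.ne', signedPower p hp}

/-- A self-map of `[0,1]` is of class `C^1`, up to the endpoints (where derivatives are
one-sided). The extension of `f` to the line is only a way to apply `ContDiffOn`: its values
outside `[0,1]` do not matter. -/
def IsC1 (f : Set.Icc (0 : ℝ) 1 → Set.Icc (0 : ℝ) 1) : Prop :=
  ContDiffOn ℝ 1 (Set.IccExtend (zero_le_one' ℝ) fun x => (f x : ℝ)) (Set.Icc 0 1)

theorem IsC1.id : IsC1 (fun x => x) := by
  refine contDiffOn_id.congr fun x hx => ?_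
  rw [Set.IccExtend_of_mem _ _ hx]
  rfl

theorem IsC1.comp {f g : Set.Icc (0 : ℝ) 1 → Set.Icc (0 : ℝ) 1} (hf : IsC1 f) (hg : IsC1 g) :
    IsC1 (fun x => f (g x)) := by
  have hmap : Set.MapsTo (Set.IccExtend (zero_le_one' ℝ) fun x => (g x : ℝ))
      (Set.Icc 0 1) (Set.Icc 0 1) := by
    intro x hx
    rw [Set.IccExtend_of_mem _ _ hx]
    exact (g ⟨x, hx⟩).2
  refine (ContDiffOn.comp hf hg hmap).congr fun x hx => ?_
  rw [Function.comp_apply, Set.IccExtend_of_mem _ _ hx, Set.IccExtend_of_mem _ _ hx,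
    Set.IccExtend_of_mem _ _ (g ⟨x, hx⟩).2]

/-- The group, under composition, of all `C^1` diffeomorphisms of `[0,1]`: the bijections of
`[0,1]` that are of class `C^1` together with their inverses. -/
def DiffC1Icc : Subgroup (Equiv.Perm (Set.Icc (0 : ℝ) 1)) where
  carrier := {f | IsC1 f ∧ IsC1 f.symm}
  one_mem' := ⟨IsC1.id, IsC1.id⟩
  mul_mem' := fun hf hg => ⟨hf.1.comp hg.1, hg.2.comp hf.2⟩
  inv_mem' := fun hf => ⟨hf.2, hf.1⟩

open Set Filter Topology

/-! Let `a`, `b`, `c` be the images of `x + 1`, `m x` and the power map: `b` conjugates `a` to `a ^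
m`, and `c` conjugates `b` to `b ^ n`. Squaring makes `a` and `b` increasing and keeps such
relations. The second relation forces derivative 1 at every fixed point of `b`
(`iccDeriv_eq_one_of_conj`): otherwise the derivatives of `b` or `b⁻¹` would be unbounded.

Then `a` is trivial (`eq_one_of_mul_eq_pow_mul`). Near a common fixed point both maps are almost
isometries, while `b⁻¹` takes displacements of `a ^ m`, `m ≥ 2`, to displacements of `a`; so `b⁻¹`
expands the displacement of `a` by 3/2. If `a` fixes every fixed point of `b`, a moved point gives a
`b⁻¹`-orbit whose displacements grow and yet tend to 0. If `a` moves a fixed point of `b`,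
displacements along a forward `b`-orbit decay at least like `(2/3)^k`, but derivative 1 at both ends
of that orbit permits only slower decay. -/

theorem perm_apply_inv_apply {α : Type*} (f : Equiv.Perm α) (x : α) : f (f⁻¹ x) = x :=
  f.apply_symm_apply x

theorem perm_inv_apply_apply {α : Type*} (f : Equiv.Perm α) (x : α) : f⁻¹ (f x) = x :=
  f.symm_apply_apply x

/-- The (one-sided at the endpoints) derivative of a self-map of `[0,1]`. -/
noncomputable def iccDeriv (f : Icc (0 : ℝ) 1 → Icc (0 : ℝ) 1) (x : Icc (0 : ℝ) 1) : ℝ :=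
  derivWithin (IccExtend (zero_le_one' ℝ) fun x => (f x : ℝ)) (Icc 0 1) x

theorem iccExtend_apply (f : Icc (0 : ℝ) 1 → Icc (0 : ℝ) 1) (x : Icc (0 : ℝ) 1) :
    IccExtend (zero_le_one' ℝ) (fun x => (f x : ℝ)) x = f x := by
  rw [IccExtend_of_mem _ _ x.2]

/-! ### Derivatives and Lipschitz bounds of C¹ self-maps -/

namespace IsC1

variable {f g : Icc (0 : ℝ) 1 → Icc (0 : ℝ) 1}

theorem hasDerivWithinAt (hf : IsC1 f) (x : Icc (0 : ℝ) 1) :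
    HasDerivWithinAt (IccExtend (zero_le_one' ℝ) fun x => (f x : ℝ)) (iccDeriv f x)
      (Icc 0 1) x :=
  ((ContDiffOn.differentiableOn hf one_ne_zero) x x.2).hasDerivWithinAt

theorem continuous (hf : IsC1 f) : Continuous f := by
  have h := continuousOn_iff_continuous_domRestrict.1 (ContDiffOn.continuousOn hf)
  refine Continuous.subtype_mk (f := fun x => (f x : ℝ)) ?_ (fun x => (f x).2) |>.congr
    fun x => rfl
  refine h.congr fun x => ?_
  exact iccExtend_apply f x

theorem continuousOn_derivWithin (hf : IsC1 f) :
    ContinuousOn (derivWithin (IccExtend (zero_le_one' ℝ) fun x => (f x : ℝ)) (Icc 0 1))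
      (Icc 0 1) :=
  ContDiffOn.continuousOn_derivWithin hf (uniqueDiffOn_Icc zero_lt_one) le_rfl

theorem iccDeriv_comp (hf : IsC1 f) (hg : IsC1 g) (x : Icc (0 : ℝ) 1) :
    iccDeriv (fun x => f (g x)) x = iccDeriv f (g x) * iccDeriv g x := by
  have hmap : MapsTo (IccExtend (zero_le_one' ℝ) fun x => (g x : ℝ)) (Icc 0 1) (Icc 0 1) := by
    intro x hx
    rw [IccExtend_of_mem _ _ hx]
    exact (g ⟨x, hx⟩).2
  have h1 := hf.hasDerivWithinAt (g x)
  rw [← iccExtend_apply g x] at h1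
  have h2 := h1.comp (x : ℝ) (hg.hasDerivWithinAt x) hmap
  refine (h2.congr (fun y hy => ?_) ?_).derivWithin (uniqueDiffOn_Icc zero_lt_one x x.2)
  · rw [Function.comp_apply, iccExtend_apply g ⟨y, hy⟩, iccExtend_apply f,
      iccExtend_apply (fun x => f (g x)) ⟨y, hy⟩]
  · rw [Function.comp_apply, iccExtend_apply g, iccExtend_apply f,
      iccExtend_apply (fun x => f (g x))]

theorem exists_abs_iccDeriv_le (hf : IsC1 f) : ∃ M, ∀ x, |iccDeriv f x| ≤ M := by
  obtain ⟨M, hM⟩ := isCompact_Icc.exists_bound_of_continuousOn hf.continuousOn_derivWithin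
  exact ⟨M, fun x => hM x x.2⟩

theorem exists_abs_sub_le (hf : IsC1 f) :
    ∃ M : ℝ, 1 ≤ M ∧ ∀ x y, |(f x : ℝ) - f y| ≤ M * |(x : ℝ) - y| := by
  obtain ⟨M, hM⟩ := hf.exists_abs_iccDeriv_le
  refine ⟨max 1 M, le_max_left _ _, fun x y => ?_⟩
  have h := (convex_Icc (0 : ℝ) 1).norm_image_sub_le_of_norm_derivWithin_le (C := max 1 M)
    (ContDiffOn.differentiableOn hf one_ne_zero)
    (fun z hz => (hM ⟨z, hz⟩).trans (le_max_right _ _)) y.2 x.2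
  rwa [iccExtend_apply, iccExtend_apply] at h

/-- Continuity of the derivative, which is where C¹ enters, keeps it above `c` near `q`; the mean
value inequality does the rest. -/
theorem exists_mul_sub_le_of_iccDeriv_eq_one (hf : IsC1 f) {q : Icc (0 : ℝ) 1}
    (hq : iccDeriv f q = 1) {c : ℝ} (hc : c < 1) :
    ∃ δ > 0, ∀ x y : Icc (0 : ℝ) 1, |(x : ℝ) - q| < δ → |(y : ℝ) - q| < δ → x ≤ y →
      c * ((y : ℝ) - x) ≤ f y - f x := by
  have hcont := hf.continuousOn_derivWithin q q.2
  have hev := hcont.eventually_const_lt (u := c) (by rw [← iccDeriv.eq_def, hq]; exact hc)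
  obtain ⟨δ, hδ, h⟩ := Metric.mem_nhdsWithin_iff.1 hev
  refine ⟨δ, hδ, fun x y hx hy hxy => ?_⟩
  have hsub : Metric.ball (q : ℝ) δ ∩ Icc 0 1 ⊆ Icc 0 1 := inter_subset_right
  have key := ((convex_ball (q : ℝ) δ).inter (convex_Icc 0 1)).mul_sub_le_image_sub_of_le_deriv
    (C := c) ((ContDiffOn.continuousOn hf).mono hsub)
    ((ContDiffOn.differentiableOn hf one_ne_zero).mono (interior_subset.trans hsub))
    (fun z hz => ?_) x ⟨hx, x.2⟩ y ⟨hy, y.2⟩ hxy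
  · rwa [iccExtend_apply, iccExtend_apply] at key
  · have hz1 : z ∈ interior (Icc (0 : ℝ) 1) := interior_mono hsub hz
    have hz2 := h (interior_subset hz)
    rw [← derivWithin_of_mem_nhds (mem_interior_iff_mem_nhds.1 hz1)]
    exact le_of_lt hz2

end IsC1

/-! ### Derivatives of diffeomorphisms at fixed points -/

namespace DiffC1Icc

variable {f g : Equiv.Perm (Icc (0 : ℝ) 1)}

theorem iccDeriv_one (x : Icc (0 : ℝ) 1) : iccDeriv (1 : Equiv.Perm (Icc (0 : ℝ) 1)) x = 1 := by
  refine ((hasDerivWithinAt_id (x : ℝ) _).congr (fun y hy => ?_) ?_).derivWithin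
    (uniqueDiffOn_Icc zero_lt_one x x.2)
  · exact iccExtend_apply _ ⟨y, hy⟩
  · exact iccExtend_apply _ x

theorem iccDeriv_mul (hf : f ∈ DiffC1Icc) (hg : g ∈ DiffC1Icc) (x : Icc (0 : ℝ) 1) :
    iccDeriv (f * g : Equiv.Perm _) x = iccDeriv f (g x) * iccDeriv g x :=
  hf.1.iccDeriv_comp hg.1 x

theorem iccDeriv_inv_mul (hf : f ∈ DiffC1Icc) (x : Icc (0 : ℝ) 1) :
    iccDeriv (f⁻¹ : Equiv.Perm _) (f x) * iccDeriv f x = 1 := by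
  rw [← iccDeriv_mul (inv_mem hf) hf, inv_mul_cancel, iccDeriv_one]

theorem iccDeriv_ne_zero (hf : f ∈ DiffC1Icc) (x : Icc (0 : ℝ) 1) : iccDeriv f x ≠ 0 :=
  right_ne_zero_of_mul_eq_one (iccDeriv_inv_mul hf x)

theorem iccDeriv_pow (hf : f ∈ DiffC1Icc) {x : Icc (0 : ℝ) 1} (hx : f x = x) (k : ℕ) :
    iccDeriv (f ^ k : Equiv.Perm _) x = iccDeriv f x ^ k := by
  induction k with
  | zero => rw [pow_zero, pow_zero, iccDeriv_one]
  | succ k ih => rw [pow_succ, iccDeriv_mul (pow_mem hf k) hf, hx, ih, pow_succ]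

theorem iccDeriv_nonneg (hf : StrictMono f) (x : Icc (0 : ℝ) 1) : 0 ≤ iccDeriv f x := by
  refine MonotoneOn.derivWithin_nonneg fun y hy z hz hyz => ?_
  rw [iccExtend_apply f ⟨y, hy⟩, iccExtend_apply f ⟨z, hz⟩]
  exact hf.monotone (show (⟨y, hy⟩ : Icc (0 : ℝ) 1) ≤ ⟨z, hz⟩ from hyz)

theorem strictMono_sq (hf : f ∈ DiffC1Icc) : StrictMono (f ^ 2 : Equiv.Perm _) := by
  have : Fact ((0 : ℝ) ≤ 1) := ⟨zero_le_one⟩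
  rcases hf.1.continuous.strictMono_of_inj f.injective with h | h
  · exact h.comp h
  · exact h.comp h

theorem strictMono_inv (hf : StrictMono f) : StrictMono (f⁻¹ : Equiv.Perm _) := by
  intro x y hxy
  rw [← hf.lt_iff_lt]
  simpa using hxy

/-- This is the Lipschitz bound for the inverse, read backwards. -/
theorem exists_mul_sub_le (hf : f ∈ DiffC1Icc) (hmono : StrictMono f) :
    ∃ c : ℝ, 0 < c ∧ c ≤ 1 ∧ ∀ x y : Icc (0 : ℝ) 1, x ≤ y →
      c * ((y : ℝ) - x) ≤ f y - f x := by
  obtain ⟨M, hM, h⟩ := IsC1.exists_abs_sub_le hf.2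
  have hM0 : 0 < M := one_pos.trans_le hM
  refine ⟨M⁻¹, inv_pos.2 hM0, inv_le_one_of_one_le₀ hM, fun x y hxy => ?_⟩
  have h1 := h (f y) (f x)
  have h2 : (f x : ℝ) ≤ f y := hmono.monotone hxy
  rw [Equiv.symm_apply_apply, Equiv.symm_apply_apply, abs_of_nonneg (sub_nonneg.2 h2),
    abs_of_nonneg (sub_nonneg.2 (show (x : ℝ) ≤ y from hxy))] at h1
  rw [inv_mul_le_iff₀ hM0]
  exact h1

/-- If `g` conjugates `f` to `f ^ n` with `n > 1`, then `f` has derivative `1` at each of its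
fixed points. -/
theorem iccDeriv_eq_one_of_conj (hf : f ∈ DiffC1Icc) (hg : g ∈ DiffC1Icc)
    (hmono : StrictMono f) {n : ℕ} (hn : 1 < n) (hgf : g * f = f ^ n * g)
    {p : Icc (0 : ℝ) 1} (hp : f p = p) : iccDeriv f p = 1 := by
  -- Pulling a fixed point `q` back to `g⁻¹ q` raises the derivative to the power `n`.
  have main : ∀ k : ℕ, ∃ q, f q = q ∧ iccDeriv f q = iccDeriv f p ^ n ^ k := by
    intro k
    induction k with
    | zero => exact ⟨p, hp, by simp⟩
    | succ k ih =>
      obtain ⟨q, hq, hd⟩ := ih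
      have hq' : f (g⁻¹ q) = g⁻¹ q := by
        apply g.injective
        have h1 := DFunLike.congr_fun hgf (g⁻¹ q)
        simp only [Equiv.Perm.mul_apply, perm_apply_inv_apply] at h1
        rw [h1, perm_apply_inv_apply]
        exact Function.IsFixedPt.perm_pow hq n
      refine ⟨g⁻¹ q, hq', ?_⟩
      have h2 : iccDeriv (g * f : Equiv.Perm _) (g⁻¹ q)
          = iccDeriv (f ^ n * g : Equiv.Perm _) (g⁻¹ q) := by rw [hgf]
      rw [iccDeriv_mul hg hf, iccDeriv_mul (pow_mem hf n) hg, hq',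
        perm_apply_inv_apply, iccDeriv_pow hf hq, mul_comm] at h2
      rw [mul_right_cancel₀ (iccDeriv_ne_zero hg _) h2, hd, ← pow_mul, pow_succ]
  have hpos : 0 < iccDeriv f p :=
    (iccDeriv_nonneg hmono p).lt_of_ne' (iccDeriv_ne_zero hf p)
  apply le_antisymm
  · by_contra! hlt
    obtain ⟨M, hM⟩ := hf.1.exists_abs_iccDeriv_le
    obtain ⟨k, hk⟩ := pow_unbounded_of_one_lt M hlt
    obtain ⟨q, -, hd⟩ := main k
    have h1 : iccDeriv f p ^ k ≤ iccDeriv f p ^ n ^ k :=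
      pow_le_pow_right₀ hlt.le (Nat.lt_pow_self hn).le
    linarith [le_abs_self (iccDeriv f q), hM q]
  · by_contra! hlt
    obtain ⟨M, hM⟩ := IsC1.exists_abs_iccDeriv_le (inv_mem hf).1
    obtain ⟨k, hk⟩ := pow_unbounded_of_one_lt M (one_lt_inv₀ hpos |>.2 hlt)
    obtain ⟨q, hq, hd⟩ := main k
    have h1 : (iccDeriv f p)⁻¹ ^ k ≤ (iccDeriv f p)⁻¹ ^ n ^ k :=
      pow_le_pow_right₀ (one_lt_inv₀ hpos |>.2 hlt).le (Nat.lt_pow_self hn).le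
    have h2 := iccDeriv_inv_mul hf q
    rw [hq, hd] at h2
    have h3 := eq_inv_of_mul_eq_one_left h2
    rw [← inv_pow] at h3
    linarith [le_abs_self (iccDeriv (f⁻¹ : Equiv.Perm _) q), hM q]

end DiffC1Icc

/-! ### Orbits converging to fixed points -/

namespace DiffC1Icc

variable {f a b : Equiv.Perm (Icc (0 : ℝ) 1)}

theorem apply_eq_of_tendsto_pow (hf : f ∈ DiffC1Icc) {x q : Icc (0 : ℝ) 1}
    (h : Tendsto (fun k : ℕ => (f ^ k) x) atTop (𝓝 q)) : f q = q := by
  refine tendsto_nhds_unique ?_ ((tendsto_add_atTop_iff_nat 1).2 h)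
  have h1 := (hf.1.continuous.tendsto q).comp h
  refine h1.congr fun k => ?_
  rw [Function.comp_apply, pow_succ', Equiv.Perm.mul_apply]

theorem monotone_pow_apply (hmono : StrictMono f) {x : Icc (0 : ℝ) 1} (hx : x ≤ f x) :
    Monotone fun k : ℕ => (f ^ k) x := by
  refine monotone_nat_of_le_succ fun k => ?_
  induction k with
  | zero => simpa using hx
  | succ k ih =>
    rw [pow_succ', pow_succ' f (k + 1), Equiv.Perm.mul_apply, Equiv.Perm.mul_apply]
    exact hmono.monotone ih

theorem antitone_pow_apply (hmono : StrictMono f) {x : Icc (0 : ℝ) 1} (hx : f x ≤ x) :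
    Antitone fun k : ℕ => (f ^ k) x := by
  refine antitone_nat_of_succ_le fun k => ?_
  induction k with
  | zero => simpa using hx
  | succ k ih =>
    rw [pow_succ' f (k + 1), pow_succ' f k, Equiv.Perm.mul_apply, Equiv.Perm.mul_apply]
    rw [pow_succ', Equiv.Perm.mul_apply] at ih
    exact hmono.monotone ih

theorem strictMono_pow (hmono : StrictMono f) (k : ℕ) :
    StrictMono (f ^ k : Equiv.Perm (Icc (0 : ℝ) 1)) := by
  rw [Equiv.Perm.coe_pow]
  exact hmono.iterate k

theorem exists_tendsto_pow_apply_of_le (hmono : StrictMono f) {x : Icc (0 : ℝ) 1}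
    (hx : x ≤ f x) :
    ∃ q, Tendsto (fun k : ℕ => (f ^ k) x) atTop (𝓝 q) ∧ ∀ k : ℕ, (f ^ k) x ≤ q := by
  have : Fact ((0 : ℝ) ≤ 1) := ⟨zero_le_one⟩
  have h := monotone_pow_apply hmono hx
  exact ⟨_, tendsto_atTop_iSup h, h.ge_of_tendsto (tendsto_atTop_iSup h)⟩

theorem exists_tendsto_pow_apply_of_ge (hmono : StrictMono f) {x : Icc (0 : ℝ) 1}
    (hx : f x ≤ x) :
    ∃ q, Tendsto (fun k : ℕ => (f ^ k) x) atTop (𝓝 q) ∧ ∀ k : ℕ, q ≤ (f ^ k) x := by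
  have : Fact ((0 : ℝ) ≤ 1) := ⟨zero_le_one⟩
  have h := antitone_pow_apply hmono hx
  exact ⟨_, tendsto_atTop_iInf h, h.le_of_tendsto (tendsto_atTop_iInf h)⟩

/-- Iterating along an orbit that converges to a fixed point with derivative `1` contracts
intervals at most subexponentially. -/
theorem exists_pow_mul_sub_le (hf : f ∈ DiffC1Icc) (hmono : StrictMono f)
    {q x₀ : Icc (0 : ℝ) 1} (hq : f q = q) (hd : iccDeriv f q = 1)
    (hlim : Tendsto (fun k : ℕ => (f ^ k) x₀) atTop (𝓝 q)) {r : ℝ} (hr0 : 0 < r) (hr : r < 1) :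
    ∃ c : ℝ, 0 < c ∧ ∀ x y : Icc (0 : ℝ) 1, x ≤ y → x ∈ uIcc x₀ q → y ∈ uIcc x₀ q →
      ∀ k : ℕ, c * r ^ k * ((y : ℝ) - x) ≤ (f ^ k) y - (f ^ k) x := by
  obtain ⟨δ, hδ, hloc⟩ := hf.1.exists_mul_sub_le_of_iccDeriv_eq_one hd hr
  obtain ⟨c, hc0, hc1, hglob⟩ := exists_mul_sub_le hf hmono
  obtain ⟨K, hK⟩ := (Metric.tendsto_atTop.1 hlim) δ hδ
  have hpowq : ∀ k : ℕ, (f ^ k) q = q := fun k => Function.IsFixedPt.perm_pow hq k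
  have hnear : ∀ x ∈ uIcc x₀ q, ∀ k ≥ K, |((f ^ k) x : ℝ) - q| < δ := by
    intro x hx k hk
    have h1 := hK k hk
    rw [Subtype.dist_eq, Real.dist_eq] at h1
    have hm := (strictMono_pow hmono k).monotone
    rcases mem_uIcc.1 hx with ⟨h2, h3⟩ | ⟨h2, h3⟩
    · have h4 := hm h2
      have h5 := hm h3
      rw [hpowq] at h5
      have h4' : ((f ^ k) x₀ : ℝ) ≤ (f ^ k) x := h4
      have h5' : ((f ^ k) x : ℝ) ≤ q := h5
      rw [abs_lt] at h1 ⊢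
      constructor <;> linarith
    · have h4 := hm h2
      have h5 := hm h3
      rw [hpowq] at h4
      have h4' : (q : ℝ) ≤ (f ^ k) x := h4
      have h5' : ((f ^ k) x : ℝ) ≤ (f ^ k) x₀ := h5
      rw [abs_lt] at h1 ⊢
      constructor <;> linarith
  refine ⟨c ^ K, pow_pos hc0 K, fun x y hxy hx hy => ?_⟩
  have hxy0 : (0 : ℝ) ≤ (y : ℝ) - x := sub_nonneg.2 hxy
  have hle : ∀ k : ℕ, (f ^ k) x ≤ (f ^ k) y := fun k => (strictMono_pow hmono k).monotone hxy
  -- Only the first `K` steps, before the orbit is within `δ` of `q`, cost the global factor `c`;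
  -- each later step costs at most `r`.
  have main : ∀ k : ℕ, c ^ min k K * r ^ k * ((y : ℝ) - x) ≤ (f ^ k) y - (f ^ k) x := by
    intro k
    induction k with
    | zero => simp
    | succ k ih =>
      have hpos : 0 ≤ c ^ min k K * r ^ k * ((y : ℝ) - x) := by positivity
      rw [pow_succ' f, Equiv.Perm.mul_apply, Equiv.Perm.mul_apply]
      rcases lt_or_ge k K with hk | hk
      · rw [min_eq_left hk.le] at ih hpos
        rw [min_eq_left (show k + 1 ≤ K from hk)]
        have h1 := hglob _ _ (hle k)
        have h2 := mul_le_mul_of_nonneg_left ih hc0.le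
        have h3 : r * (c * (c ^ k * r ^ k * ((y : ℝ) - x)))
            ≤ 1 * (c * (c ^ k * r ^ k * ((y : ℝ) - x))) :=
          mul_le_mul_of_nonneg_right hr.le (mul_nonneg hc0.le hpos)
        calc _ = r * (c * (c ^ k * r ^ k * ((y : ℝ) - x))) := by ring
          _ ≤ _ := by linarith
      · rw [min_eq_right hk] at ih
        rw [min_eq_right (hk.trans k.le_succ)]
        have h1 := hloc _ _ (hnear x hx k hk) (hnear y hy k hk) (hle k)
        have h2 := mul_le_mul_of_nonneg_left ih hr0.le
        calc _ = r * (c ^ K * r ^ k * ((y : ℝ) - x)) := by ring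
          _ ≤ _ := by linarith
  intro k
  refine le_trans ?_ (main k)
  have : c ^ K ≤ c ^ min k K := pow_le_pow_of_le_one hc0.le hc1 (min_le_right _ _)
  gcongr

/-! ### Consequences of the relation `b * a = a ^ m * b` -/

section Relation

variable {m : ℕ}

theorem pow_mul_eq_of_mul_eq (h : b * a = a ^ m * b) (k : ℕ) :
    b ^ k * a = a ^ m ^ k * b ^ k := by
  have h' : SemiconjBy b a (a ^ m) := h
  induction k with
  | zero => simp
  | succ k ih =>
    have ih' : SemiconjBy (b ^ k) a (a ^ m ^ k) := ih
    rw [pow_succ' b, pow_succ' m, pow_mul]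
    exact (h'.pow_right (m ^ k)).mul_left ih'

/-- At a common fixed point, `a` has derivative `1` as soon as `b` conjugates `a` to `a ^ m`
with `m > 1`. -/
theorem iccDeriv_eq_one_of_common_fixed (ha : a ∈ DiffC1Icc) (hb : b ∈ DiffC1Icc)
    (hamono : StrictMono a) (hm : 1 < m) (h : b * a = a ^ m * b) {q : Icc (0 : ℝ) 1}
    (haq : a q = q) (hbq : b q = q) : iccDeriv a q = 1 := by
  have h1 : iccDeriv (b * a : Equiv.Perm _) q = iccDeriv (a ^ m * b : Equiv.Perm _) q := by
    rw [h]
  rw [iccDeriv_mul hb ha, iccDeriv_mul (pow_mem ha m) hb, haq, hbq, iccDeriv_pow ha haq,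
    mul_comm] at h1
  have h2 := mul_right_cancel₀ (iccDeriv_ne_zero hb q) h1
  have h3 : iccDeriv a q ^ (m - 1) = 1 := by
    have h4 : iccDeriv a q ^ (m - 1) * iccDeriv a q = 1 * iccDeriv a q := by
      rw [← pow_succ, Nat.sub_add_cancel hm.le, one_mul, ← h2]
    exact mul_right_cancel₀ (iccDeriv_ne_zero ha q) h4
  exact (pow_eq_one_iff_of_nonneg (iccDeriv_nonneg hamono q) (by omega)).1 h3

/-- Near a common fixed point at which `b` has derivative `1`, the displacement of `a` is
expanded by `b⁻¹`. -/
theorem exists_displacement_expansion (ha : a ∈ DiffC1Icc) (hb : b ∈ DiffC1Icc)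
    (hamono : StrictMono a) (hbmono : StrictMono b) (hm : 1 < m) (h : b * a = a ^ m * b)
    {q : Icc (0 : ℝ) 1} (haq : a q = q) (hbq : b q = q) (hd : iccDeriv b q = 1) :
    ∃ δ > 0, ∀ x : Icc (0 : ℝ) 1, |(x : ℝ) - q| < δ → x ≤ a x →
      3 / 2 * ((a x : ℝ) - x) ≤ a (b⁻¹ x) - b⁻¹ x := by
  have hda := iccDeriv_eq_one_of_common_fixed ha hb hamono hm h haq hbq
  have hdb : iccDeriv (b⁻¹ : Equiv.Perm _) q = 1 := by
    have := iccDeriv_inv_mul hb q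
    rwa [hbq, hd, mul_one] at this
  -- Two displacements of `a` total at least `1 + 9/10` of the first, and `b⁻¹` keeps `9/10` of
  -- that: `1.71 ≥ 3/2`.
  have h910 : (9 / 10 : ℝ) < 1 := by norm_num
  obtain ⟨δ₁, hδ₁, h₁⟩ := ha.1.exists_mul_sub_le_of_iccDeriv_eq_one hda h910
  obtain ⟨δ₂, hδ₂, h₂⟩ := IsC1.exists_mul_sub_le_of_iccDeriv_eq_one (inv_mem hb).1 hdb h910
  have hcont : ∀ j : ℕ, ∀ᶠ x in 𝓝 q, |((a ^ j) x : ℝ) - q| < min δ₁ δ₂ := by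
    intro j
    have hc := ((pow_mem ha j).1.continuous.tendsto q).eventually
      (Metric.ball_mem_nhds _ (lt_min hδ₁ hδ₂))
    filter_upwards [hc] with x hx
    have hfix : (a ^ j) q = q := Function.IsFixedPt.perm_pow haq j
    rwa [hfix] at hx
  obtain ⟨δ, hδ, hball⟩ := Metric.eventually_nhds_iff.1 ((hcont 0).and ((hcont 1).and (hcont 2)))
  refine ⟨δ, hδ, fun x hx hax => ?_⟩
  obtain ⟨e0, e1, e2⟩ := hball (show dist x q < δ from hx)
  rw [pow_zero, Equiv.Perm.one_apply] at e0
  rw [pow_one] at e1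
  rw [pow_two, Equiv.Perm.mul_apply] at e2
  have d1 := h₁ x (a x) (e0.trans_le (min_le_left _ _)) (e1.trans_le (min_le_left _ _)) hax
  have haax : x ≤ a (a x) := hax.trans (hamono.monotone hax)
  have d2 := h₂ x (a (a x)) (e0.trans_le (min_le_right _ _)) (e2.trans_le (min_le_right _ _))
    haax
  have hrel : a (b⁻¹ x) = b⁻¹ ((a ^ m) x) := by
    apply b.injective
    rw [perm_apply_inv_apply, ← Equiv.Perm.mul_apply, h, Equiv.Perm.mul_apply,
      perm_apply_inv_apply]
  have hpow : a (a x) ≤ (a ^ m) x := by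
    have := monotone_pow_apply hamono hax (show 2 ≤ m from hm)
    simpa [pow_two] using this
  have d3 : (b⁻¹ (a (a x)) : ℝ) ≤ a (b⁻¹ x) := by
    rw [hrel]
    exact (strictMono_inv hbmono).monotone hpow
  have hax' : (x : ℝ) ≤ a x := hax
  linarith

theorem lt_apply_pow_inv (hbmono : StrictMono b) (hamono : StrictMono a)
    (h : b * a = a ^ m * b) {y : Icc (0 : ℝ) 1} (hm : 0 < m) (hy : y < a y) (k : ℕ) :
    (b⁻¹ ^ k) y < a ((b⁻¹ ^ k) y) := by
  rw [← (strictMono_pow hbmono k).lt_iff_lt, ← Equiv.Perm.mul_apply (b ^ k) a,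
    pow_mul_eq_of_mul_eq h, Equiv.Perm.mul_apply, inv_pow, perm_apply_inv_apply]
  exact hy.trans_le (monotone_pow_apply hamono hy.le (Nat.one_le_pow k m hm))

/-- If every fixed point of `b` is a fixed point of `a`, no point is moved up by `a`. -/
theorem not_lt_apply_of_fixed_subset (ha : a ∈ DiffC1Icc) (hb : b ∈ DiffC1Icc)
    (hamono : StrictMono a) (hbmono : StrictMono b) (hm : 1 < m) (h : b * a = a ^ m * b)
    (hfix : ∀ p, b p = p → iccDeriv b p = 1) (hsub : ∀ p, b p = p → a p = p)
    (y : Icc (0 : ℝ) 1) : ¬ y < a y := by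
  intro hy
  obtain ⟨q, hq⟩ : ∃ q, Tendsto (fun k : ℕ => (b⁻¹ ^ k) y) atTop (𝓝 q) := by
    rcases le_total y (b⁻¹ y) with h1 | h1
    · obtain ⟨q, hq, -⟩ := exists_tendsto_pow_apply_of_le (strictMono_inv hbmono) h1
      exact ⟨q, hq⟩
    · obtain ⟨q, hq, -⟩ := exists_tendsto_pow_apply_of_ge (strictMono_inv hbmono) h1
      exact ⟨q, hq⟩
  have hbq : b q = q := by
    have h1 := apply_eq_of_tendsto_pow (inv_mem hb) hq
    rw [← h1, perm_apply_inv_apply, h1]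
  have haq := hsub q hbq
  obtain ⟨δ, hδ, hexp⟩ := exists_displacement_expansion ha hb hamono hbmono hm h haq hbq
    (hfix q hbq)
  obtain ⟨K, hK⟩ := (Metric.tendsto_atTop.1 hq) δ hδ
  have hlt := lt_apply_pow_inv hbmono hamono h (zero_lt_one.trans hm) hy
  set D : ℕ → ℝ := fun k => (a ((b⁻¹ ^ k) y) : ℝ) - (b⁻¹ ^ k) y with hD
  have hDpos : ∀ k, 0 < D k := fun k => sub_pos.2 (hlt k)
  have hstep : ∀ k ≥ K, D k ≤ D (k + 1) := by
    intro k hk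
    have h1 := hexp _ (hK k hk) (hlt k).le
    rw [← Equiv.Perm.mul_apply b⁻¹, ← pow_succ'] at h1
    have h2 := hDpos k
    simp only [hD] at h2 ⊢
    linarith
  have hlow : ∀ j, D K ≤ D (K + j) := by
    intro j
    induction j with
    | zero => exact le_rfl
    | succ j ih => exact ih.trans (hstep (K + j) (Nat.le_add_right _ _))
  -- The orbit converges to `q`, which `a` fixes.
  have hDlim : Tendsto D atTop (𝓝 0) := by
    have h1 := (continuous_subtype_val.tendsto _).comp ((ha.1.continuous.tendsto q).comp hq)
    have h2 := (continuous_subtype_val.tendsto _).comp hq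
    have h3 := h1.sub h2
    rw [haq, sub_self] at h3
    exact h3
  have h4 : Tendsto (fun j => D (K + j)) atTop (𝓝 0) := by
    simpa only [add_comm] using (tendsto_add_atTop_iff_nat K).2 hDlim
  exact absurd (ge_of_tendsto' h4 hlow) (not_le.2 (hDpos K))

/-- No fixed point of `b` is moved up by `a`. -/
theorem not_lt_apply_of_fixed (ha : a ∈ DiffC1Icc) (hb : b ∈ DiffC1Icc)
    (hamono : StrictMono a) (hbmono : StrictMono b) (hm : 1 < m) (h : b * a = a ^ m * b)
    (hfix : ∀ p, b p = p → iccDeriv b p = 1) {p₀ : Icc (0 : ℝ) 1} (hp₀ : b p₀ = p₀) :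
    ¬ p₀ < a p₀ := by
  intro hap
  have hbk : ∀ k : ℕ, (b ^ k) p₀ = p₀ := fun k => Function.IsFixedPt.perm_pow hp₀ k
  -- Since `b` fixes `p₀`, the `b`-orbit of `a p₀` runs inside the `a`-orbit of `p₀`; hence its
  -- limit `v` is fixed by both maps.
  have horb : ∀ k : ℕ, (b ^ k) (a p₀) = (a ^ m ^ k) p₀ := fun k => by
    rw [← Equiv.Perm.mul_apply, pow_mul_eq_of_mul_eq h, Equiv.Perm.mul_apply, hbk]
  obtain ⟨v, hv, hvle⟩ := exists_tendsto_pow_apply_of_le hamono hap.le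
  have hav := apply_eq_of_tendsto_pow ha hv
  have hzv : Tendsto (fun k : ℕ => (b ^ k) (a p₀)) atTop (𝓝 v) := by
    simp only [horb]
    exact hv.comp (tendsto_pow_atTop_atTop_of_one_lt hm)
  have hbv := apply_eq_of_tendsto_pow hb hzv
  have hbinv : b⁻¹ (a p₀) < a p₀ := by
    rw [← hbmono.lt_iff_lt, perm_apply_inv_apply]
    have h1 := horb 1
    rw [pow_one, pow_one] at h1
    rw [h1]
    have h2 : a p₀ < a (a p₀) := hamono hap
    refine h2.trans_le ?_
    have := monotone_pow_apply hamono hap.le (show 2 ≤ m from hm)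
    simpa [pow_two] using this
  have hbinvmono := strictMono_inv hbmono
  obtain ⟨p, hwp, hple⟩ := exists_tendsto_pow_apply_of_ge hbinvmono hbinv.le
  have hbp' := apply_eq_of_tendsto_pow (inv_mem hb) hwp
  have hbp : b p = p := by
    rw [← hbp', perm_apply_inv_apply, hbp']
  have hpz : p < a p₀ := by
    have := hple 1
    rw [pow_one] at this
    exact this.trans_lt hbinv
  have hp₀inv : ∀ k : ℕ, (b⁻¹ ^ k) p₀ = p₀ := fun k => by
    rw [inv_pow, Equiv.Perm.inv_eq_iff_eq, hbk]
  have hp₀p : p₀ ≤ p := by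
    refine ge_of_tendsto' hwp fun k => ?_
    have := (strictMono_pow hbinvmono k).monotone hap.le
    rwa [hp₀inv] at this
  have hdp : iccDeriv (b⁻¹ : Equiv.Perm _) p = 1 := by
    have := iccDeriv_inv_mul hb p
    rwa [hbp, hfix p hbp, mul_one] at this
  have hr0 : (0 : ℝ) < 9 / 10 := by norm_num
  have hr1 : (9 / 10 : ℝ) < 1 := by norm_num
  obtain ⟨c₁, hc₁, hw⟩ := exists_pow_mul_sub_le (inv_mem hb) hbinvmono hbp' hdp hwp hr0 hr1
  obtain ⟨c₂, hc₂, hz⟩ := exists_pow_mul_sub_le hb hbmono hbv (hfix v hbv) hzv hr0 hr1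
  obtain ⟨c₃, hc₃, -, ha₃⟩ := exists_mul_sub_le ha hamono
  have hzlev : ∀ k : ℕ, (b ^ k) (a p₀) ≤ v := fun k => by
    rw [horb]
    exact hvle _
  have hz0v : a p₀ ≤ v := by simpa using hzlev 0
  set D : ℕ → ℝ := fun k => (a ((b ^ k) (a p₀)) : ℝ) - (b ^ k) (a p₀) with hD
  have hDnonneg : ∀ k, (b ^ k) (a p₀) ≤ a ((b ^ k) (a p₀)) := fun k => by
    rw [horb, ← Equiv.Perm.mul_apply, ← pow_succ']
    exact monotone_pow_apply hamono hap.le (Nat.le_succ _)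
  -- The displacement is the `b ^ k`-image of the interval from `a p₀` to `a w`, with `w = b⁻ᵏ (a
  -- p₀)`. Going back towards `p` and forward towards `v` each costs `(9/10)^k`, whence `81/100`.
  have hlower : ∀ k : ℕ, c₂ * c₃ * c₁ * (81 / 100) ^ k * ((a p₀ : ℝ) - p) ≤ D k := by
    intro k
    set w := (b⁻¹ ^ k) (a p₀) with hwdef
    have hbw : (b ^ k) w = a p₀ := by
      rw [hwdef, inv_pow, perm_apply_inv_apply]
    have hpk : (b⁻¹ ^ k) p = p := Function.IsFixedPt.perm_pow hbp' k
    have h1 := hw p (a p₀) hpz.le right_mem_uIcc left_mem_uIcc k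
    rw [hpk] at h1
    have hpw : p ≤ w := hple k
    have hp₀w : p₀ ≤ w := hp₀p.trans hpw
    have h2 := ha₃ p₀ w hp₀w
    have hawv : a w ≤ v := by
      rw [← hav]
      refine hamono.monotone (le_trans ?_ hz0v)
      exact antitone_pow_apply hbinvmono hbinv.le (Nat.zero_le k)
    have h3 := hz (a p₀) (a w) (hamono.monotone hp₀w) left_mem_uIcc
      (by rw [uIcc_of_le hz0v]; exact ⟨hamono.monotone hp₀w, hawv⟩) k
    have h4 : (b ^ k) (a w) = a ((b ^ k) (a p₀)) := by
      rw [← Equiv.Perm.mul_apply, pow_mul_eq_of_mul_eq h, Equiv.Perm.mul_apply, hbw, horb,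
        ← Equiv.Perm.mul_apply, ← Equiv.Perm.mul_apply, ← pow_succ, ← pow_succ']
    rw [h4] at h3
    refine le_trans ?_ h3
    have hp₀p' : (p₀ : ℝ) ≤ p := hp₀p
    have h5 : c₁ * (9 / 10) ^ k * ((a p₀ : ℝ) - p) ≤ (w : ℝ) - p₀ := by linarith
    have h6 : c₃ * (c₁ * (9 / 10) ^ k * ((a p₀ : ℝ) - p)) ≤ (a w : ℝ) - a p₀ :=
      (mul_le_mul_of_nonneg_left h5 hc₃.le).trans h2
    have h7 := mul_le_mul_of_nonneg_left h6 (show 0 ≤ c₂ * (9 / 10 : ℝ) ^ k by positivity)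
    refine le_trans (le_of_eq ?_) h7
    rw [show (81 / 100 : ℝ) = 9 / 10 * (9 / 10) by norm_num, mul_pow]
    ring
  obtain ⟨δ, hδ, hexp⟩ := exists_displacement_expansion ha hb hamono hbmono hm h hav hbv
    (hfix v hbv)
  obtain ⟨K, hK⟩ := (Metric.tendsto_atTop.1 hzv) δ hδ
  have hstep : ∀ k ≥ K, 3 / 2 * D (k + 1) ≤ D k := by
    intro k hk
    have h1 := hexp _ (hK (k + 1) (hk.trans k.le_succ)) (hDnonneg (k + 1))
    have h2 : b⁻¹ ((b ^ (k + 1)) (a p₀)) = (b ^ k) (a p₀) := by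
      rw [pow_succ', Equiv.Perm.mul_apply, perm_inv_apply_apply]
    rwa [h2] at h1
  have hupper : ∀ j : ℕ, (3 / 2) ^ j * D (K + j) ≤ D K := by
    intro j
    induction j with
    | zero => simp
    | succ j ih =>
      have h1 := mul_le_mul_of_nonneg_left (hstep (K + j) (Nat.le_add_right _ _))
        (show (0 : ℝ) ≤ (3 / 2) ^ j by positivity)
      rw [pow_succ, mul_assoc]
      exact h1.trans ih
  set C : ℝ := c₂ * c₃ * c₁ * (81 / 100) ^ K * ((a p₀ : ℝ) - p) with hC
  have hCpos : 0 < C := by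
    have : (0 : ℝ) < (a p₀ : ℝ) - p := sub_pos.2 hpz
    positivity
  -- The two rates clash because `3/2 * 81/100 = 243/200 > 1`.
  obtain ⟨j, hj⟩ := pow_unbounded_of_one_lt (D K / C) (show (1 : ℝ) < 243 / 200 by norm_num)
  rw [div_lt_iff₀ hCpos] at hj
  have h8 := mul_le_mul_of_nonneg_left (hlower (K + j)) (show (0 : ℝ) ≤ (3 / 2) ^ j by positivity)
  have h9 : (243 / 200 : ℝ) ^ j * C
      = (3 / 2) ^ j * (c₂ * c₃ * c₁ * (81 / 100) ^ (K + j) * ((a p₀ : ℝ) - p)) := by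
    rw [hC, show (243 / 200 : ℝ) = 3 / 2 * (81 / 100) by norm_num, mul_pow, pow_add]
    ring
  linarith [hupper j]

/-- If `b` conjugates `a` to `a ^ m` with `m > 1` and has derivative `1` at all its fixed
points, then `a` is trivial. -/
theorem eq_one_of_mul_eq_pow_mul (ha : a ∈ DiffC1Icc) (hb : b ∈ DiffC1Icc)
    (hamono : StrictMono a) (hbmono : StrictMono b) (hm : 1 < m) (h : b * a = a ^ m * b)
    (hfix : ∀ p, b p = p → iccDeriv b p = 1) : a = 1 := by
  have hinv : b * a⁻¹ = a⁻¹ ^ m * b := by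
    have : SemiconjBy b a (a ^ m) := h
    rw [inv_pow]
    exact this.inv_right
  have hamono' := strictMono_inv hamono
  have lt_inv : ∀ {y}, a y < y → y < a⁻¹ y := fun {y} hy => by
    rw [← hamono.lt_iff_lt, perm_apply_inv_apply]
    exact hy
  have hsub : ∀ p, b p = p → a p = p := fun p hp => le_antisymm
    (not_lt.1 (not_lt_apply_of_fixed ha hb hamono hbmono hm h hfix hp))
    (not_lt.1 fun hlt =>
      not_lt_apply_of_fixed (inv_mem ha) hb hamono' hbmono hm hinv hfix hp (lt_inv hlt))
  refine Equiv.ext fun y => le_antisymm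
    (not_lt.1 (not_lt_apply_of_fixed_subset ha hb hamono hbmono hm h hfix hsub y))
    (not_lt.1 fun hlt => not_lt_apply_of_fixed_subset (inv_mem ha) hb hamono' hbmono hm hinv hfix
      (fun p hp => ?_) y (lt_inv hlt))
  rw [Equiv.Perm.inv_eq_iff_eq, hsub p hp]

end Relation

end DiffC1Icc

/-! ### The relations in the affine-power group, and the conclusion -/

theorem mulLeft₀_mul_addRight (m : ℕ) (hm : (m : ℝ) ≠ 0) :
    Equiv.mulLeft₀ (m : ℝ) hm * Equiv.addRight (1 : ℝ)
      = Equiv.addRight (1 : ℝ) ^ m * Equiv.mulLeft₀ (m : ℝ) hm := by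
  ext x
  simp [Equiv.Perm.mul_apply, mul_add]

theorem signedPower_mul_mulLeft₀ {l : ℝ} (hl : 0 < l) {n : ℕ} (hn : (0 : ℝ) < n) :
    signedPower n hn * Equiv.mulLeft₀ l hl.ne'
      = Equiv.mulLeft₀ l hl.ne' ^ n * signedPower n hn := by
  have hpow : ∀ (k : ℕ) (x : ℝ), (Equiv.mulLeft₀ l hl.ne' ^ k) x = l ^ k * x := by
    intro k x
    induction k with
    | zero => simp
    | succ k ih =>
      rw [pow_succ', Equiv.Perm.mul_apply, ih, pow_succ']
      exact (mul_assoc _ _ _).symm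
  ext x
  rw [Equiv.Perm.mul_apply, Equiv.Perm.mul_apply, hpow]
  change Real.sign (l * x) * |l * x| ^ (n : ℝ) = l ^ n * (Real.sign x * |x| ^ (n : ℝ))
  have hsign : Real.sign (l * x) = Real.sign x := by
    rcases lt_trichotomy x 0 with h | rfl | h
    · rw [Real.sign_of_neg h, Real.sign_of_neg (mul_neg_of_pos_of_neg hl h)]
    · rw [mul_zero]
    · rw [Real.sign_of_pos h, Real.sign_of_pos (mul_pos hl h)]
  rw [hsign, abs_mul, abs_of_pos hl,
    Real.mul_rpow hl.le (abs_nonneg x), Real.rpow_natCast]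
  ring

theorem mainTheorem7 (m n : ℕ) (hm : 1 < m) (hn : 1 < n)
    (φ : affinePowerGroup (m : ℝ) (n : ℝ)
        (Nat.cast_pos.mpr (zero_lt_one.trans hm)) (Nat.cast_pos.mpr (zero_lt_one.trans hn)) →*
      DiffC1Icc) :
    ¬ Function.Injective φ := by
  intro hφ
  have hm0 : (0 : ℝ) < m := Nat.cast_pos.mpr (zero_lt_one.trans hm)
  have hn0 : (0 : ℝ) < n := Nat.cast_pos.mpr (zero_lt_one.trans hn)
  let a : affinePowerGroup (m : ℝ) n hm0 hn0 :=
    ⟨Equiv.addRight 1, Subgroup.subset_closure (by simp)⟩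
  let b : affinePowerGroup (m : ℝ) n hm0 hn0 :=
    ⟨Equiv.mulLeft₀ (m : ℝ) hm0.ne', Subgroup.subset_closure (by simp)⟩
  let c : affinePowerGroup (m : ℝ) n hm0 hn0 :=
    ⟨signedPower n hn0, Subgroup.subset_closure (by simp)⟩
  have hba : SemiconjBy b a (a ^ m) := Subtype.ext (mulLeft₀_mul_addRight m hm0.ne')
  have hcb : SemiconjBy c b (b ^ n) := Subtype.ext (signedPower_mul_mulLeft₀ hm0 hn0)
  -- Squares are needed because the images may reverse orientation; the exponent `m` becomes `m ^
  -- 2`.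
  have hba2 : SemiconjBy (b ^ 2) (a ^ 2) ((a ^ 2) ^ m ^ 2) := by
    have h1 : SemiconjBy b (a ^ m) (a ^ m ^ 2) := by
      rw [pow_two m, pow_mul]
      exact hba.pow_right m
    rw [← pow_mul, mul_comm 2, pow_mul, pow_two b]
    exact (h1.mul_left hba).pow_right 2
  have hcb2 : SemiconjBy c (b ^ 2) ((b ^ 2) ^ n) := by
    rw [← pow_mul, mul_comm 2, pow_mul]
    exact hcb.pow_right 2
  have h1 := congrArg Subtype.val (hba2.map φ).eq
  have h2 := congrArg Subtype.val (hcb2.map φ).eq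
  simp only [map_pow, Subgroup.coe_mul, Subgroup.coe_pow] at h1 h2
  have hA := (φ a).2
  have hB := (φ b).2
  have hBmono := DiffC1Icc.strictMono_sq hB
  have key := DiffC1Icc.eq_one_of_mul_eq_pow_mul (pow_mem hA 2) (pow_mem hB 2)
    (DiffC1Icc.strictMono_sq hA) hBmono (Nat.one_lt_pow two_ne_zero hm) h1
    fun p hp => DiffC1Icc.iccDeriv_eq_one_of_conj (pow_mem hB 2) (φ c).2 hBmono hn h2 hp
  have h3 : a ^ 2 = 1 := by
    apply hφ
    rw [map_pow, map_one]
    exact Subtype.ext key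
  -- The square of the translation sends 0 to 2, so it is not the identity.
  have h4 := DFunLike.congr_fun (congrArg Subtype.val h3) (0 : ℝ)
  have h5 : (0 : ℝ) + 1 + 1 = 0 := h4
  norm_num at h5
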